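/- Let $S$ be a finite set with at least three elements and let $M=(m_{st})_{s,t\in S}$ be a symmetric matrix of positive integers with $m_{ss}=1$ and $m_{st}>1$ for $s\neq t$. Write $(s,t)_m=stst\cdots$ ($m$ factors), and let $G=\langle S\mid (s,t)_{m_{st}}=(t,s)_{m_{st}},\ s,t\in S\rangle$ and $P=\langle S\mid (s,t)_{m_{st}}=(t,s)_{m_{st}},\ s,t\in S\rangle^{+}$ be the Artin–Tits group and the Artin–Tits monoid of $M$. Assume that they are of finite type, i.e. that the Coxeter group obtained from $G$ by adding the relations $s^2=1$ ($s\in S$) is finite. (Then $P$ embeds in $G$, and any two principal right ideals of $P$ intersect in a principal right ideal.) For $g,h\in P$ write $g\prec h$ if $h\in gP$. Let $\Omega$ be the set of all non-empty subsets $x\subseteq P$ that are hereditary ($h\prec g\in x$ implies $h\in x$) and directed (for $g,h\in x$ there is $f\in x$ with $g\prec f$ and $h\prec f$), with the topology of pointwise convergence of indicator functions $P\to\{0,1\}$; a set $x$ corresponds to the character $\chi$ of the semilattice of principal right ideals of $P$ with $\chi(pP)=1$ if and only if $p\in x$. The group $G$ acts partially on $\Omega$: $g\in G$ is defined at $x$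 and $g.x=y$ if and only if there are $p,q\in P$ with $g=pq^{-1}$, $q\in x$, $p\in y$, and, for all $h\in P$, $ph\in y\Leftrightarrow qh\in x$. Let $\tilde\Omega_\infty\subseteq\Omega$ be the invariant subspace obtained by removing all the points $[p]=\{h\in P: h\prec p\}$, $p\in P$, and the point $\infty=P$, and let $G\ltimes\tilde\Omega_\infty$ be the partial transformation groupoid: its elements are the pairs $(g,x)\in G\times\tilde\Omega_\infty$ with $g.x$ defined, $(g,x)$ has source $x$ and range $g.x$, $(k,g.x)(g,x)=(kg,x)$, and the topology is that of a subspace of $G\times\tilde\Omega_\infty$ with $G$ discrete. Suppose that there are $s,t\in S$ with $2<m_{st}<\infty$. Then the groupoid $\mathcal G=G\ltimes\tilde\Omega_\infty$ is not amenable. Here a locally compact étale groupoid $\mathcal G$ with range map $r$ and fibres $\mathcal G^u=r^{-1}(u)$ is called amenable if for all compact sets $K\subseteq\mathcal G^{(0)}$ and $C\subseteq\mathcal G$ and all $\varepsilon>0$ there is a non-negative $f\in C_c(\mathcal G)$ such that $\sum_{\beta\in\mathcal G^u}f(\beta)\le 1$ for all $u\in\mathcal G^{(0)}$, $\sum_{\beta\in\mathcal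 G^u}f(\beta)>1-\varepsilon$ for all $u\in K$, and $\sum_{\beta\in\mathcal G^{r(\gamma)}}|f(\gamma^{-1}\beta)-f(\beta)|<\varepsilon$ for all $\gamma\in C$. -/

import Mathlib

/-! ### Artin–Tits groups and monoids -/

/-- The alternating product `(a, b)_n = a b a b ⋯` with `n` factors. -/
def altProd {A : Type*} [Monoid A] (a b : A) : ℕ → A
  | 0 => 1
  | n + 1 => a * altProd b a n

namespace CoxeterMatrix

variable {S : Type*} (M : CoxeterMatrix S)

/-- The defining relations `(s, t)_{m_{st}} = (t, s)_{m_{st}}` of the Artin–Tits monoid. (An entry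
`0` of a Coxeter matrix stands for `∞`; the relation it gives is the trivial one, `1 = 1`.) -/
inductive ArtinRel : FreeMonoid S → FreeMonoid S → Prop
  | braid (s t : S) :
      ArtinRel (altProd (FreeMonoid.of s) (FreeMonoid.of t) (M s t))
        (altProd (FreeMonoid.of t) (FreeMonoid.of s) (M s t))

/-- The Artin–Tits monoid `P = ⟨ S | (s,t)_{m_{st}} = (t,s)_{m_{st}} ⟩⁺`. -/
abbrev ArtinMonoid : Type _ := PresentedMonoid M.ArtinRel

/-- The defining relators `(s, t)_{m_{st}} · (t, s)_{m_{st}}⁻¹` of the Artin–Tits group. -/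
def artinRelators : Set (FreeGroup S) :=
  Set.range fun st : S × S =>
    altProd (FreeGroup.of st.1) (FreeGroup.of st.2) (M st.1 st.2) *
      (altProd (FreeGroup.of st.2) (FreeGroup.of st.1) (M st.1 st.2))⁻¹

/-- The Artin–Tits group `G = ⟨ S | (s,t)_{m_{st}} = (t,s)_{m_{st}} ⟩`. -/
abbrev ArtinGroup : Type _ := PresentedGroup M.artinRelators

theorem map_altProd {A B : Type*} [Monoid A] [Monoid B] (φ : A →* B) (a b : A) (n : ℕ) :
    φ (altProd a b n) = altProd (φ a) (φ b) n := by
  induction n generalizing a b with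
  | zero => exact map_one φ
  | succ n ih => simp only [altProd, map_mul, ih]

/-- The canonical homomorphism `P → G` that is the identity on generators. -/
def artinMonoidToGroup : M.ArtinMonoid →* M.ArtinGroup :=
  PresentedMonoid.lift (fun s => (PresentedGroup.of s : M.ArtinGroup)) (by
    rintro _ _ ⟨s, t⟩
    have h : PresentedGroup.mk M.artinRelators
        (altProd (FreeGroup.of s) (FreeGroup.of t) (M s t) *
          (altProd (FreeGroup.of t) (FreeGroup.of s) (M s t))⁻¹) = 1 :=
      PresentedGroup.one_of_mem ⟨(s, t), rfl⟩
    rw [map_mul, map_inv, mul_inv_eq_one, map_altProd, map_altProd] at h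
    rw [map_altProd, map_altProd]
    exact h)

/-- `M` is of finite type: all entries are (finite) positive integers and the Coxeter group
`W` with Coxeter matrix `M` is finite. -/
def IsFiniteType : Prop := (∀ s t : S, 0 < M s t) ∧ Finite M.Group

end CoxeterMatrix

/-! ### The spectrum of a right LCM monoid -/

/-- A point of the spectrum `Ω` of a right LCM monoid `P`, as a non-empty directed hereditary
subset of `P`: the character `χ` of the semilattice of principal right ideals corresponds to
`{p | χ (p P) = 1}`. Here `g ∣ h` means `h ∈ g P`. -/
@[ext]
structure MonoidSpectrum (P : Type*) [Monoid P] where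
  /-- The set of all `p` with `χ (p P) = 1`. -/
  carrier : Set P
  nonempty : carrier.Nonempty
  hereditary : ∀ g ∈ carrier, ∀ h, h ∣ g → h ∈ carrier
  directed : ∀ g ∈ carrier, ∀ h ∈ carrier, ∃ f ∈ carrier, g ∣ f ∧ h ∣ f

namespace MonoidSpectrum

variable {P : Type*} [Monoid P]

open Classical in
/-- The topology of pointwise convergence of characters `P → {0, 1}`, with `{0, 1}` discrete. -/
noncomputable instance : TopologicalSpace (MonoidSpectrum P) :=
  TopologicalSpace.induced (fun (x : MonoidSpectrum P) (p : P) => decide (p ∈ x.carrier))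
    (inferInstance : TopologicalSpace (P → Bool))

/-- The point `[p] = {h | p ∈ h P}` of `Ω` given by `p ∈ P`. -/
def principal (p : P) : MonoidSpectrum P where
  carrier := {h | h ∣ p}
  nonempty := ⟨p, dvd_refl p⟩
  hereditary := fun _ hg _ hh => dvd_trans hh hg
  directed := fun _ hg _ hh => ⟨p, dvd_refl p, hg, hh⟩

variable (P) in
/-- `Ω̃_∞`: what is left of `Ω` when the points `[p]`, `p ∈ P`, and the point `∞` (the character
with constant value `1`, i.e. the set `P` itself) are removed. -/
def tildeInfty : Set (MonoidSpectrum P) :=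
  {x | (∀ p : P, x ≠ principal p) ∧ x.carrier ≠ Set.univ}

theorem one_mem (x : MonoidSpectrum P) : (1 : P) ∈ x.carrier := by
  obtain ⟨g, hg⟩ := x.nonempty
  exact x.hereditary g hg 1 (one_dvd g)

variable {G : Type*} [Group G]

/-- The partial action of `G` on `Ω`, for a monoid homomorphism `ι : P → G`: `ActsTo ι g x y` says
that `x` is in the domain of `g` and `g.x = y`. For characters this means that `g = p q⁻¹` with
`χ (q P) = 1`, and that `g.χ` is the character with `(g.χ) (p h P) = χ (q h P)` for all `h ∈ P`. As
`(g.χ) (p P) = 1`, this forces `(g.χ) (z P) = χ (q h P)` if `z P ∩ p P = p h P`, and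
`(g.χ) (z P) = 0` if `z P ∩ p P = ∅`. -/
def ActsTo (ι : P →* G) (g : G) (x y : MonoidSpectrum P) : Prop :=
  ∃ p q : P, g = ι p * (ι q)⁻¹ ∧ q ∈ x.carrier ∧ p ∈ y.carrier ∧
    ∀ h : P, p * h ∈ y.carrier ↔ q * h ∈ x.carrier

theorem ActsTo.one (ι : P →* G) (x : MonoidSpectrum P) : ActsTo ι 1 x x :=
  ⟨1, 1, by simp, x.one_mem, x.one_mem, fun _ => Iff.rfl⟩

theorem ActsTo.symm {ι : P →* G} {g : G} {x y : MonoidSpectrum P} (h : ActsTo ι g x y) :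
    ActsTo ι g⁻¹ y x := by
  obtain ⟨p, q, rfl, hq, hp, H⟩ := h
  exact ⟨q, p, by simp, hp, hq, fun k => (H k).symm⟩

theorem ActsTo.comp {ι : P →* G} {g k : G} {x y z : MonoidSpectrum P} (h₁ : ActsTo ι g x y)
    (h₂ : ActsTo ι k y z) : ActsTo ι (k * g) x z := by
  obtain ⟨p, q, rfl, hq, hp, H⟩ := h₁
  obtain ⟨p', q', rfl, hq', hp', H'⟩ := h₂
  obtain ⟨r, hr, ⟨a, rfl⟩, ⟨b, hb⟩⟩ := y.directed p hp q' hq'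
  refine ⟨p' * b, q * a, ?_, (H a).1 hr, (H' b).2 (hb ▸ hr), fun c => ?_⟩
  · have e : ι p * ι a = ι q' * ι b := by rw [← map_mul, ← map_mul, hb]
    have e' : (ι q')⁻¹ * ι p = ι b * (ι a)⁻¹ := by
      rw [inv_mul_eq_iff_eq_mul, ← mul_assoc, ← e, mul_inv_cancel_right]
    calc ι p' * (ι q')⁻¹ * (ι p * (ι q)⁻¹) = ι p' * ((ι q')⁻¹ * ι p) * (ι q)⁻¹ := by group
      _ = ι (p' * b) * (ι (q * a))⁻¹ := by rw [e', map_mul, map_mul]; group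
  · rw [mul_assoc, H', ← mul_assoc, ← hb, mul_assoc, H, ← mul_assoc]

end MonoidSpectrum

/-! ### The partial transformation groupoid -/

section Groupoids

open CategoryTheory

/-- The unit space of the partial transformation groupoid `G ⋉ X` of the partial action of `G` on
the subspace `X` of `Ω`. -/
def TransformationGroupoid {P G : Type*} [Monoid P] [Group G] (_ι : P →* G)
    (X : Set (MonoidSpectrum P)) : Type _ := X

/-- The space of all arrows of a groupoid. -/
structure GroupoidArrow (X : Type*) [Groupoid X] where
  /-- The source of the arrow. -/
  src : X
  /-- The range of the arrow. -/
  tgt : X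
  /-- The arrow itself. -/
  hom : src ⟶ tgt

namespace TransformationGroupoid

variable {P G : Type*} [Monoid P] [Group G] (ι : P →* G) (X : Set (MonoidSpectrum P))

noncomputable instance : TopologicalSpace (TransformationGroupoid ι X) :=
  inferInstanceAs (TopologicalSpace X)

/-- An arrow with source `x` and range `y` is a group element `g` with `g.x = y`, and the product of
`(k, g.x)` and `(g, x)` is `(k g, x)`. -/
instance : Groupoid (TransformationGroupoid ι X) where
  Hom x y := {g : G // MonoidSpectrum.ActsTo ι g x.1 y.1}
  id x := ⟨1, MonoidSpectrum.ActsTo.one ι x.1⟩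
  comp g k := ⟨k.1 * g.1, g.2.comp k.2⟩
  inv g := ⟨g.1⁻¹, g.2.symm⟩
  id_comp g := Subtype.ext (mul_one g.1)
  comp_id g := Subtype.ext (one_mul g.1)
  assoc g k l := Subtype.ext (mul_assoc l.1 k.1 g.1).symm
  inv_comp g := Subtype.ext (mul_inv_cancel g.1)
  comp_inv g := Subtype.ext (inv_mul_cancel g.1)

/-- The arrow space carries the topology of a subspace of `G × X`, with `G` discrete; the arrow
`g : x → g.x` is the pair `(g, x)`. -/
noncomputable instance : TopologicalSpace (GroupoidArrow (TransformationGroupoid ι X)) :=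
  TopologicalSpace.induced (fun γ => (γ.hom.1, γ.src))
    (@instTopologicalSpaceProd G (TransformationGroupoid ι X) ⊥ inferInstance)

end TransformationGroupoid

/-! ### Amenability -/

/-- (Topological) amenability of a locally compact étale groupoid `𝒢` with unit space `X`: there are
non-negative functions `f ∈ C_c(𝒢)` with `∑_{β ∈ 𝒢ᵘ} f(β) ≤ 1` for all units `u`, such that
`∑_{β ∈ 𝒢ᵘ} f(β)` is as close to `1` as desired, uniformly for `u` in any given compact subset of `X`,
and `∑_{β ∈ 𝒢^{r(γ)}} |f(γ⁻¹ β) - f(β)|` is as small as desired, uniformly for `γ` in any given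
compact subset of `𝒢`. Here `𝒢ᵘ` is the set of arrows with range `u`. -/
def IsAmenableGroupoid (X : Type*) [Groupoid X] [TopologicalSpace X]
    [TopologicalSpace (GroupoidArrow X)] : Prop :=
  ∀ (K : Set X) (C : Set (GroupoidArrow X)), IsCompact K → IsCompact C → ∀ ε : ℝ, 0 < ε →
    ∃ f : GroupoidArrow X → ℝ, Continuous f ∧ HasCompactSupport f ∧ (∀ γ, 0 ≤ f γ) ∧
      (∀ u : X, ∑' β : (Σ w : X, w ⟶ u), ENNReal.ofReal (f ⟨β.1, u, β.2⟩) ≤ 1) ∧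
      (∀ u ∈ K, ENNReal.ofReal (1 - ε) <
        ∑' β : (Σ w : X, w ⟶ u), ENNReal.ofReal (f ⟨β.1, u, β.2⟩)) ∧
      (∀ γ ∈ C, ∑' β : (Σ w : X, w ⟶ γ.tgt),
        ENNReal.ofReal |f ⟨β.1, γ.src, β.2 ≫ Groupoid.inv γ.hom⟩ - f ⟨β.1, γ.tgt, β.2⟩|
          < ENNReal.ofReal ε)

end Groupoids

/-! ### Approximate invariance against a covering by two small sets -/

section Paradox

open CategoryTheory

/-! The elements of `P` written with the letters `s` and `t` alone form a point `x` of the spectrum: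
any two of them divide a common power of the element `(s,t)_{m_{st}}`. The point is not principal,
since lengths are unbounded, and is not `∞`, since there is a third letter. The generators `s` and
`t` of `G` fix it, so they lie in its isotropy group, and it suffices to play ping-pong there.

For this, `G` is represented on `ℝ^S` by transvections attached to an alternating form with values
`± 2 cos (π / m_{st})`. Left multiplication of `g` by `s ^ k` keeps row `s` of its matrix and adds
`k ω(t,s)` times row `s` to row `t`. As `m_{st} ≥ 3` gives `|ω(t,s)| ≥ 1`, for `k ≥ 3` an element
whose row `s` is at least as long as its row `t` goes to one whose row `t` is strictly longer
(`norm_artinRow_lt`).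

Hence the set where row `s` dominates is disjoint from its translates by `s ^ 3` and `s ^ 6`, which
are disjoint from each other, and likewise for `t`. Each set carries about a third of the mass of an
almost invariant function, yet the two cover all arrows with range `x`. -/

/-- If the translates of `B` by `1`, `c₁`, `c₂` are pairwise disjoint, then a function that is
invariant under `c₁` and `c₂` up to an error has at most a third of its mass in `B`. -/
theorem three_mul_tsum_indicator_le {Y : Type*} (F E₁ E₂ : Y → ENNReal) (c₁ c₂ : Equiv.Perm Y)
    (B : Set Y) (h₁ : ∀ y ∈ B, c₁ y ∉ B) (h₂ : ∀ y ∈ B, c₂ y ∉ B)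
    (h₁₂ : ∀ y ∈ B, ∀ z ∈ B, c₁ y ≠ c₂ z)
    (hE₁ : ∀ y, F (c₁.symm y) ≤ F y + E₁ y) (hE₂ : ∀ y, F (c₂.symm y) ≤ F y + E₂ y) :
    3 * ∑' y, B.indicator F y ≤ ∑' y, F y + ∑' y, E₁ y + ∑' y, E₂ y := by
  have e₁ : ∑' y, B.indicator F y = ∑' y, B.indicator F (c₁.symm y) :=
    (c₁.symm.tsum_eq (B.indicator F)).symm
  have e₂ : ∑' y, B.indicator F y = ∑' y, B.indicator F (c₂.symm y) :=
    (c₂.symm.tsum_eq (B.indicator F)).symm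
  have e : 3 * ∑' y, B.indicator F y = ∑' y, B.indicator F y +
      ∑' y, B.indicator F (c₁.symm y) + ∑' y, B.indicator F (c₂.symm y) := by
    rw [← e₁, ← e₂]; ring
  rw [e, ← ENNReal.tsum_add, ← ENNReal.tsum_add, ← ENNReal.tsum_add, ← ENNReal.tsum_add]
  refine ENNReal.tsum_le_tsum fun y => ?_
  by_cases hy : y ∈ B
  · have n₁ : c₁.symm y ∉ B := fun h => h₁ _ h (by simpa using hy)
    have n₂ : c₂.symm y ∉ B := fun h => h₂ _ h (by simpa using hy)
    simp only [Set.indicator_of_mem hy, Set.indicator_of_notMem n₁, Set.indicator_of_notMem n₂,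
      add_zero, add_assoc]
    exact le_self_add
  · rw [Set.indicator_of_notMem hy, zero_add]
    by_cases hy₁ : c₁.symm y ∈ B
    · have n₂ : c₂.symm y ∉ B := fun h => h₁₂ _ hy₁ _ h (by simp)
      rw [Set.indicator_of_mem hy₁, Set.indicator_of_notMem n₂, add_zero]
      exact (hE₁ y).trans le_self_add
    · rw [Set.indicator_of_notMem hy₁, zero_add]
      refine (Set.indicator_le_self B F _).trans ((hE₂ y).trans ?_)
      exact add_le_add_left le_self_add _

variable {X : Type*} [Groupoid X]

/-- Composition with an element of the isotropy group at `u`, on the arrows with range `u`. -/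
def isotropyPerm {u : X} (h : u ⟶ u) : Equiv.Perm (Σ w : X, w ⟶ u) where
  toFun β := ⟨β.1, β.2 ≫ h⟩
  invFun β := ⟨β.1, β.2 ≫ Groupoid.inv h⟩
  left_inv β := by simp
  right_inv β := by simp

/-- A groupoid is not amenable if the arrows with some range `u` are covered by two sets each of
which has three disjoint translates under the powers of some element of the isotropy group. -/
theorem not_isAmenableGroupoid_of_isotropy [TopologicalSpace X]
    [TopologicalSpace (GroupoidArrow X)] {u : X} (h k : u ⟶ u) (B B' : Set (Σ w : X, w ⟶ u))
    (hB : ∀ β ∈ B, (⟨β.1, β.2 ≫ h⟩ : Σ w : X, w ⟶ u) ∉ B)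
    (hB₂ : ∀ β ∈ B, (⟨β.1, β.2 ≫ h ≫ h⟩ : Σ w : X, w ⟶ u) ∉ B)
    (hB' : ∀ β ∈ B', (⟨β.1, β.2 ≫ k⟩ : Σ w : X, w ⟶ u) ∉ B')
    (hB₂' : ∀ β ∈ B', (⟨β.1, β.2 ≫ k ≫ k⟩ : Σ w : X, w ⟶ u) ∉ B')
    (hcover : ∀ β, β ∈ B ∨ β ∈ B') : ¬ IsAmenableGroupoid X := by
  intro hX
  -- With error `1 / 10`, each set has mass at most `(1 + 2 / 10) / 3 = 2 / 5`; together this is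
  -- less than `9 / 10`.
  obtain ⟨f, -, -, -, hle, hgt, hinv⟩ := hX {u}
    {⟨u, u, h⟩, ⟨u, u, h ≫ h⟩, ⟨u, u, k⟩, ⟨u, u, k ≫ k⟩} isCompact_singleton
    (Set.Finite.isCompact (by simp)) (1 / 10) (by norm_num)
  set F : (Σ w : X, w ⟶ u) → ENNReal := fun β => ENNReal.ofReal (f ⟨β.1, u, β.2⟩)
  let E (g : u ⟶ u) (β : Σ w : X, w ⟶ u) : ENNReal :=
    ENNReal.ofReal |f ⟨β.1, u, β.2 ≫ Groupoid.inv g⟩ - f ⟨β.1, u, β.2⟩|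
  have hE (g : u ⟶ u) (β : Σ w : X, w ⟶ u) : F ((isotropyPerm g).symm β) ≤ F β + E g β := by
    refine le_trans (ENNReal.ofReal_le_ofReal ?_) ENNReal.ofReal_add_le
    have := le_abs_self (f ⟨β.1, u, β.2 ≫ Groupoid.inv g⟩ - f ⟨β.1, u, β.2⟩)
    change f ⟨β.1, u, β.2 ≫ Groupoid.inv g⟩ ≤ _
    linarith
  have third (g : u ⟶ u) (Z : Set (Σ w : X, w ⟶ u))
      (hZ : ∀ β ∈ Z, (⟨β.1, β.2 ≫ g⟩ : Σ w : X, w ⟶ u) ∉ Z)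
      (hZ₂ : ∀ β ∈ Z, (⟨β.1, β.2 ≫ g ≫ g⟩ : Σ w : X, w ⟶ u) ∉ Z)
      (l₁ : ∑' β, E g β < ENNReal.ofReal (1 / 10))
      (l₂ : ∑' β, E (g ≫ g) β < ENNReal.ofReal (1 / 10)) :
      3 * ∑' β, Z.indicator F β ≤ ENNReal.ofReal (6 / 5) := by
    refine (three_mul_tsum_indicator_le F (E g) (E (g ≫ g)) (isotropyPerm g)
      (isotropyPerm (g ≫ g)) Z hZ hZ₂ ?_ (hE g) (hE (g ≫ g))).trans ?_
    · intro y hy z hz he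
      -- Cancelling one `g` shows that `y` is the translate of `z` by `g`, so two disjointness
      -- conditions give the third.
      have he' : isotropyPerm g y = isotropyPerm g ⟨z.1, z.2 ≫ g⟩ := by
        rw [he]; simp [isotropyPerm]
      exact hZ z hz ((isotropyPerm g).injective he' ▸ hy)
    · calc ∑' β, F β + ∑' β, E g β + ∑' β, E (g ≫ g) β
          ≤ ENNReal.ofReal 1 + ENNReal.ofReal (1 / 10) + ENNReal.ofReal (1 / 10) := by
            gcongr
            simpa using hle u
        _ = ENNReal.ofReal (6 / 5) := by
            rw [← ENNReal.ofReal_add, ← ENNReal.ofReal_add] <;> norm_num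
  have t₁ := third h B hB hB₂ (hinv ⟨u, u, h⟩ (by simp)) (hinv ⟨u, u, h ≫ h⟩ (by simp))
  have t₂ := third k B' hB' hB₂' (hinv ⟨u, u, k⟩ (by simp)) (hinv ⟨u, u, k ≫ k⟩ (by simp))
  have hsum : ∑' β, F β ≤ ∑' β, B.indicator F β + ∑' β, B'.indicator F β := by
    rw [← ENNReal.tsum_add]
    refine ENNReal.tsum_le_tsum fun β => ?_
    rcases hcover β with hβ | hβ
    · rw [Set.indicator_of_mem hβ]; exact le_self_add
    · rw [Set.indicator_of_mem hβ]; exact le_add_self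
  have lower : ENNReal.ofReal (1 - 1 / 10) < ∑' β, F β := hgt u rfl
  have : ENNReal.ofReal (27 / 10) < ENNReal.ofReal (12 / 5) := by
    calc ENNReal.ofReal (27 / 10) = 3 * ENNReal.ofReal (1 - 1 / 10) := by
          rw [← ENNReal.ofReal_ofNat 3, ← ENNReal.ofReal_mul (by norm_num)]; norm_num
      _ < 3 * ∑' β, F β := by
          rw [ENNReal.mul_lt_mul_iff_right (by norm_num) (by norm_num)]; exact lower
      _ ≤ 3 * (∑' β, B.indicator F β + ∑' β, B'.indicator F β) := by gcongr
      _ ≤ ENNReal.ofReal (6 / 5) + ENNReal.ofReal (6 / 5) := by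
          rw [mul_add]; exact add_le_add t₁ t₂
      _ = ENNReal.ofReal (12 / 5) := by
          rw [← ENNReal.ofReal_add] <;> norm_num
  rw [ENNReal.ofReal_lt_ofReal_iff (by norm_num)] at this
  norm_num at this

end Paradox

/-! ### Braid relations between 2 × 2 matrices -/

section AlternatingProducts

theorem altProd_mul_swap {A : Type*} [Monoid A] {a b d : A} (hab : a * d = d * b)
    (hba : b * d = d * a) (n : ℕ) : altProd a b n * d = d * altProd b a n := by
  induction n generalizing a b with
  | zero => simp [altProd]
  | succ n ih => rw [altProd, altProd, mul_assoc, ih hba hab, ← mul_assoc, hab, mul_assoc]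

/-- Each `d` moved to the left exchanges `a` and `b`, which turns the alternating product into a
power of `a * d`. -/
theorem altProd_mul_pow {A : Type*} [Monoid A] {a b d : A} (hab : a * d = d * b)
    (hba : b * d = d * a) (n : ℕ) : altProd a b n * d ^ n = (a * d) ^ n := by
  induction n with
  | zero => simp [altProd]
  | succ n ih =>
    rw [altProd, pow_succ', pow_succ', ← ih, mul_assoc, ← mul_assoc _ d, altProd_mul_swap hba hab]
    simp only [mul_assoc]

open Real in
-- The entries obey the Chebyshev recurrence; the factor `sin θ` avoids a division.
theorem sin_smul_matrix_pow (θ : ℝ) (n : ℕ) :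
    sin θ • (!![2 * cos θ, -1; 1, 0] : Matrix (Fin 2) (Fin 2) ℝ) ^ n =
      !![sin ((n + 1) * θ), -sin (n * θ); sin (n * θ), -sin ((n - 1) * θ)] := by
  induction n with
  | zero => ext i j; fin_cases i <;> fin_cases j <;> simp
  | succ n ih =>
    have key : sin ((n + 1 + 1) * θ) = 2 * cos θ * sin ((n + 1) * θ) - sin (n * θ) := by
      have e₁ : ((n : ℝ) + 1 + 1) * θ = (n + 1) * θ + θ := by ring
      have e₂ : (n : ℝ) * θ = (n + 1) * θ - θ := by ring
      rw [e₁, e₂, sin_add, sin_sub]; ring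
    have key' : sin ((n + 1) * θ) = 2 * cos θ * sin (n * θ) - sin ((n - 1) * θ) := by
      have e₁ : ((n : ℝ) + 1) * θ = n * θ + θ := by ring
      have e₂ : ((n : ℝ) - 1) * θ = n * θ - θ := by ring
      rw [e₁, e₂, sin_add, sin_sub]; ring
    rw [pow_succ, ← smul_mul_assoc, ih]
    push_cast
    rw [key]
    ext i j
    fin_cases i <;> fin_cases j <;> simp [Matrix.mul_apply, Fin.sum_univ_two]
    · ring
    · rw [key']; ring

open Real in
/-- The braid relation of length `m` for a pair of elementary matrices. -/
theorem altProd_transvection (m : ℕ) (hm : 2 ≤ m) :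
    altProd (!![1, 2 * cos (π / m); 0, 1] : Matrix (Fin 2) (Fin 2) ℝ)
        !![1, 0; -(2 * cos (π / m)), 1] m =
      altProd !![1, 0; -(2 * cos (π / m)), 1] !![1, 2 * cos (π / m); 0, 1] m := by
  set θ : ℝ := π / m with hθ
  have hm0 : (0 : ℝ) < m := by positivity
  have hm1 : (1 : ℝ) < m := by exact_mod_cast hm
  have hsin : sin θ ≠ 0 :=
    (sin_pos_of_pos_of_lt_pi (by positivity) (div_lt_self pi_pos hm1)).ne'
  have hmθ : m * θ = π := by rw [hθ]; field_simp
  set a : Matrix (Fin 2) (Fin 2) ℝ := !![1, 2 * cos θ; 0, 1] with ha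
  set b : Matrix (Fin 2) (Fin 2) ℝ := !![1, 0; -(2 * cos θ), 1] with hb
  -- The quarter turn, conjugation by which exchanges `a` and `b`.
  set d : Matrix (Fin 2) (Fin 2) ℝ := !![0, -1; 1, 0] with hd
  have hab : a * d = d * b := by
    ext i j
    fin_cases i <;> fin_cases j <;> simp [ha, hb, hd, Matrix.mul_apply, Fin.sum_univ_two]
  have hba : b * d = d * a := by
    ext i j
    fin_cases i <;> fin_cases j <;> simp [ha, hb, hd, Matrix.mul_apply, Fin.sum_univ_two]
  have had : a * d = !![2 * cos θ, -1; 1, 0] := by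
    ext i j
    fin_cases i <;> fin_cases j <;> simp [ha, hd, Matrix.mul_apply, Fin.sum_univ_two]
  have hdu : IsUnit d := by
    rw [Matrix.isUnit_iff_isUnit_det]; simp [hd, Matrix.det_fin_two]
  -- `a * d` has determinant `1` and trace `2 cos θ`, hence eigenvalues `exp (± i π / m)`.
  have hscalar : (a * d) ^ m = -1 := by
    have h := sin_smul_matrix_pow θ m
    have e₁ : ((m : ℝ) + 1) * θ = θ + π := by rw [add_mul, hmθ]; ring
    have e₂ : ((m : ℝ) - 1) * θ = π - θ := by rw [sub_mul, hmθ]; ring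
    rw [← had, e₁, e₂, hmθ, sin_add_pi, sin_pi_sub, sin_pi] at h
    have h' : sin θ • (a * d) ^ m = sin θ • (-1) := by
      rw [h]
      ext i j
      fin_cases i <;> fin_cases j <;> simp
    exact smul_right_injective _ hsin h'
  have hswap : (b * d) ^ m * d = d * (a * d) ^ m := by
    have hc : SemiconjBy d (a * d) (b * d) := by
      rw [SemiconjBy, ← mul_assoc, ← hba]
    exact (hc.pow_right m).eq.symm
  have hscalar' : (b * d) ^ m = -1 := by
    rw [hscalar, mul_neg, mul_one, ← neg_one_mul] at hswap
    exact hdu.mul_right_cancel hswap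
  refine (hdu.pow m).mul_right_cancel ?_
  rw [altProd_mul_pow hab hba, altProd_mul_pow hba hab, hscalar, hscalar']

end AlternatingProducts

/-! ### The representation by transvections and ping-pong on rows -/

section TransvectionRepresentation

variable {S : Type*}

/-- The transvection `v ↦ v + v s • ω(·, s)` of `ℝ^S` given by an alternating matrix `ω`. -/
def coordTransvection (ω : S → S → ℝ) (hω : ∀ s, ω s s = 0) (s : S) :
    (S → ℝ) ≃ₗ[ℝ] (S → ℝ) where
  toFun v r := v r + ω r s * v s
  invFun v r := v r - ω r s * v s
  map_add' v w := by ext r; simp; ring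
  map_smul' c v := by ext r; simp; ring
  left_inv v := by ext r; simp [hω]
  right_inv v := by ext r; simp [hω]

theorem coordTransvection_apply (ω : S → S → ℝ) (hω : ∀ s, ω s s = 0) (s r : S) (v : S → ℝ) :
    coordTransvection ω hω s v r = v r + ω r s * v s := rfl

theorem exists_altProd_coordTransvection_apply (ω : S → S → ℝ) (hω : ∀ s, ω s s = 0) (s t : S)
    (n : ℕ) (v : S → ℝ) : ∃ p q : ℝ, ∀ r,
      altProd (coordTransvection ω hω s) (coordTransvection ω hω t) n v r =
        v r + p * ω r s + q * ω r t := by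
  induction n generalizing s t with
  | zero => exact ⟨0, 0, fun r => by simp [altProd]⟩
  | succ n ih =>
    obtain ⟨p, q, h⟩ := ih t s
    refine ⟨q + (v s + p * ω s t + q * ω s s), p, fun r => ?_⟩
    rw [altProd, LinearEquiv.mul_apply, coordTransvection_apply, h, h]
    ring

open Matrix in
-- The coordinates `s` and `t` evolve independently of the others, which reduces the braid relation
-- to 2 × 2 matrices.
theorem altProd_coordTransvection_pair (ω : S → S → ℝ) (hω : ∀ s, ω s s = 0) (s t : S)
    (n : ℕ) (v : S → ℝ) :
    ![altProd (coordTransvection ω hω s) (coordTransvection ω hω t) n v s,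
        altProd (coordTransvection ω hω s) (coordTransvection ω hω t) n v t] =
      altProd (!![1, 0; ω t s, 1] : Matrix (Fin 2) (Fin 2) ℝ) !![1, ω s t; 0, 1] n *ᵥ ![v s, v t] ∧
    ![altProd (coordTransvection ω hω t) (coordTransvection ω hω s) n v s,
        altProd (coordTransvection ω hω t) (coordTransvection ω hω s) n v t] =
      altProd (!![1, ω s t; 0, 1] : Matrix (Fin 2) (Fin 2) ℝ) !![1, 0; ω t s, 1] n *ᵥ
        ![v s, v t] := by
  induction n with
  | zero => simp [altProd]
  | succ n ih =>
    simp only [altProd, ← Matrix.mulVec_mulVec, ← ih.1, ← ih.2, LinearEquiv.mul_apply,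
      coordTransvection_apply]
    constructor <;> ext i <;> fin_cases i <;> simp [hω] <;> ring

open Real in
-- Both sides change `v` by a combination of `ω(·, s)` and `ω(·, t)`. Its coefficients can be read
-- off from the coordinates `t` and `s` when `cos (π / m) ≠ 0`; for `m = 2` this fails, and
-- commutation is assumed instead.
theorem altProd_coordTransvection (ω : S → S → ℝ) (hω : ∀ s, ω s s = 0) (s t : S) (m : ℕ)
    (hm : 2 ≤ m) (hst : ω s t = 2 * cos (π / m)) (hts : ω t s = -(2 * cos (π / m)))
    (hm2 : m = 2 → coordTransvection ω hω s * coordTransvection ω hω t =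
      coordTransvection ω hω t * coordTransvection ω hω s) :
    altProd (coordTransvection ω hω s) (coordTransvection ω hω t) m =
      altProd (coordTransvection ω hω t) (coordTransvection ω hω s) m := by
  rcases hm.eq_or_lt with rfl | hm3
  · simpa [altProd] using hm2 rfl
  have hcos : 0 < cos (π / m) := by
    have hmR : (2 : ℝ) < m := by exact_mod_cast hm3
    have : π / m < π / 2 := div_lt_div_of_pos_left pi_pos (by norm_num) hmR
    exact cos_pos_of_mem_Ioo ⟨by linarith [div_nonneg pi_pos.le (by positivity : (0:ℝ) ≤ m),
      pi_pos], this⟩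
  refine LinearEquiv.ext fun v => funext fun r => ?_
  obtain ⟨p, q, h⟩ := exists_altProd_coordTransvection_apply ω hω s t m v
  obtain ⟨q', p', h'⟩ := exists_altProd_coordTransvection_apply ω hω t s m v
  have pair := altProd_coordTransvection_pair ω hω s t m v
  rw [hst, hts, altProd_transvection m hm] at pair
  have e := pair.1.trans pair.2.symm
  have es := congrFun e 0
  have et := congrFun e 1
  simp only [Matrix.cons_val_zero, Matrix.cons_val_one] at es et
  rw [h, h', hω, hst] at es
  rw [h, h', hω, hts] at et
  have hq : q = q' := by
    have : (q - q') * (2 * cos (π / m)) = 0 := by linarith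
    rcases mul_eq_zero.1 this with h | h <;> linarith
  have hp : p = p' := by
    have : (p - p') * (2 * cos (π / m)) = 0 := by linarith
    rcases mul_eq_zero.1 this with h | h <;> linarith
  rw [h, h', hp, hq]
  ring

namespace CoxeterMatrix

variable (M : CoxeterMatrix S)

open Classical Real in
/-- An alternating form with the values `± 2 cos (π / m_{st})`. -/
noncomputable def altForm (s t : S) : ℝ :=
  if s = t then 0 else if WellOrderingRel s t then 2 * cos (π / M s t) else -(2 * cos (π / M s t))

theorem altForm_self (s : S) : M.altForm s s = 0 := by simp [altForm]

open Real in
theorem altForm_of_rel {s t : S} (h : WellOrderingRel s t) :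
    M.altForm s t = 2 * cos (π / M s t) ∧ M.altForm t s = -(2 * cos (π / M s t)) := by
  have hne : s ≠ t := fun e => irrefl_of WellOrderingRel t (e ▸ h)
  have h' : ¬ WellOrderingRel t s := fun h' => asymm_of WellOrderingRel h h'
  simp [altForm, hne, hne.symm, h, h', M.symmetric s t]

theorem altForm_eq_zero {s t : S} (h : M s t = 2) : M.altForm s t = 0 := by
  simp [altForm, h]

theorem one_le_abs_altForm {s t : S} (h : 2 < M s t) : 1 ≤ |M.altForm s t| := by
  have hne : s ≠ t := by rintro rfl; simp at h
  have hmR : (3 : ℝ) ≤ M s t := by exact_mod_cast h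
  have hle : Real.pi / M s t ≤ Real.pi / 3 :=
    div_le_div_of_nonneg_left Real.pi_pos.le (by norm_num) hmR
  have hcos : 1 / 2 ≤ Real.cos (Real.pi / M s t) := by
    rw [← Real.cos_pi_div_three]
    exact Real.cos_le_cos_of_nonneg_of_le_pi (by positivity) (by linarith [Real.pi_pos]) hle
  rw [altForm, if_neg hne]
  split_ifs
  · exact le_trans (by linarith) (le_abs_self _)
  · rw [abs_neg]; exact le_trans (by linarith) (le_abs_self _)

theorem altProd_altForm (s t : S) :
    altProd (coordTransvection M.altForm M.altForm_self s)
        (coordTransvection M.altForm M.altForm_self t) (M s t) =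
      altProd (coordTransvection M.altForm M.altForm_self t)
        (coordTransvection M.altForm M.altForm_self s) (M s t) := by
  have key (s t : S) (h : WellOrderingRel s t) :
      altProd (coordTransvection M.altForm M.altForm_self s)
          (coordTransvection M.altForm M.altForm_self t) (M s t) =
        altProd (coordTransvection M.altForm M.altForm_self t)
          (coordTransvection M.altForm M.altForm_self s) (M s t) := by
    have hne : s ≠ t := fun e => irrefl_of WellOrderingRel t (e ▸ h)
    by_cases h0 : M s t = 0
    · rw [h0]; rfl
    have hm : 2 ≤ M s t := by
      have := M.off_diagonal s t hne
      omega
    refine altProd_coordTransvection _ _ s t _ hm (M.altForm_of_rel h).1 (M.altForm_of_rel h).2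
      fun h2 => ?_
    have hst := M.altForm_eq_zero h2
    have hts := M.altForm_eq_zero ((M.symmetric t s).trans h2)
    refine LinearEquiv.ext fun v => funext fun r => ?_
    simp only [LinearEquiv.mul_apply, coordTransvection_apply, hst, hts]
    ring
  rcases trichotomous_of WellOrderingRel s t with h | rfl | h
  · exact key s t h
  · rfl
  · rw [M.symmetric s t]; exact (key t s h).symm

/-- The representation of the Artin–Tits group by transvections. -/
noncomputable def artinRep : M.ArtinGroup →* ((S → ℝ) ≃ₗ[ℝ] (S → ℝ)) :=
  PresentedGroup.toGroup (f := coordTransvection M.altForm M.altForm_self) (by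
    rintro _ ⟨⟨s, t⟩, rfl⟩
    rw [map_mul, map_inv, mul_inv_eq_one, map_altProd, map_altProd]
    simpa using M.altProd_altForm s t)

theorem artinRep_of_apply (s r : S) (v : S → ℝ) :
    M.artinRep (PresentedGroup.of s) v r = v r + M.altForm r s * v s := by
  simp [artinRep, PresentedGroup.toGroup.of, coordTransvection_apply]

open Classical in
/-- The row with index `r` of the matrix of `g` in the representation by transvections. -/
noncomputable def artinRow (r : S) (g : M.ArtinGroup) : S → ℝ :=
  fun j => M.artinRep g (Pi.single j 1) r

theorem artinRow_of_mul (s r : S) (g : M.ArtinGroup) :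
    M.artinRow r (PresentedGroup.of s * g) = M.artinRow r g + M.altForm r s • M.artinRow s g := by
  ext j
  simp [artinRow, map_mul, LinearEquiv.mul_apply, artinRep_of_apply]

theorem artinRow_of_pow_mul (s r : S) (g : M.ArtinGroup) (k : ℕ) :
    M.artinRow r ((PresentedGroup.of s) ^ k * g) =
      M.artinRow r g + (k * M.altForm r s) • M.artinRow s g := by
  induction k generalizing r with
  | zero => simp
  | succ k ih =>
    -- Row `s` never changes because `ω(s,s) = 0`, so the multiples accumulate linearly.
    rw [pow_succ', mul_assoc, artinRow_of_mul, ih, ih, altForm_self]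
    simp only [mul_zero, zero_smul, add_zero, add_assoc, ← add_smul]
    push_cast
    congr 2
    ring

theorem artinRow_ne_zero [Finite S] (r : S) (g : M.ArtinGroup) : M.artinRow r g ≠ 0 := by
  classical
  intro h
  have hz : LinearMap.proj r ∘ₗ (M.artinRep g).toLinearMap = (0 : (S → ℝ) →ₗ[ℝ] ℝ) := by
    refine LinearMap.pi_ext' fun j => LinearMap.ext_ring ?_
    simpa [artinRow] using congrFun h j
  have := LinearMap.congr_fun hz ((M.artinRep g).symm (Pi.single r 1))
  simp at this

/-- The new row `t` has norm at least `3 ‖row s‖ - ‖row t‖ ≥ 2 ‖row s‖`, and row `s` is nonzero and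
unchanged. -/
theorem norm_artinRow_lt [Fintype S] {s t : S} (hst : 2 < M s t) {g : M.ArtinGroup}
    (hg : ‖M.artinRow t g‖ ≤ ‖M.artinRow s g‖) {k : ℕ} (hk : 3 ≤ k) :
    ‖M.artinRow s ((PresentedGroup.of s) ^ k * g)‖ <
      ‖M.artinRow t ((PresentedGroup.of s) ^ k * g)‖ := by
  rw [artinRow_of_pow_mul, artinRow_of_pow_mul, altForm_self, mul_zero, zero_smul, add_zero]
  have hpos : 0 < ‖M.artinRow s g‖ := norm_pos_iff.2 (M.artinRow_ne_zero s g)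
  have hform : 1 ≤ |M.altForm t s| := M.one_le_abs_altForm (by rwa [M.symmetric])
  have hkR : (3 : ℝ) ≤ k := by exact_mod_cast hk
  have hnorm : 3 * ‖M.artinRow s g‖ ≤ ‖(k * M.altForm t s) • M.artinRow s g‖ := by
    rw [norm_smul, Real.norm_eq_abs, abs_mul, Nat.abs_cast]
    gcongr
    nlinarith
  have := norm_sub_le (M.artinRow t g + (k * M.altForm t s) • M.artinRow s g) (M.artinRow t g)
  rw [add_sub_cancel_left] at this
  linarith

end CoxeterMatrix

end TransvectionRepresentation

/-! ### The point of the spectrum given by two letters -/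

section Parabolic

/-- The value is symmetric in `a` and `b`, so sending letters to `0` or `1` respects the braid
relations. -/
theorem altProd_of_idempotent {A : Type*} [CommMonoid A] {a b : A} (ha : a * a = a)
    (hb : b * b = b) (n : ℕ) : altProd a b (n + 2) = a * b := by
  induction n generalizing a b with
  | zero => simp [altProd]
  | succ n ih => rw [altProd, ih hb ha, mul_left_comm, ha, mul_comm]

theorem exists_altProd_succ_eq_mul {A : Type*} [Monoid A] (a b : A) (n : ℕ) :
    ∃ z, (z = a ∨ z = b) ∧ altProd a b (n + 1) = altProd a b n * z := by
  induction n generalizing a b with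
  | zero => exact ⟨a, .inl rfl, by simp [altProd]⟩
  | succ n ih =>
    obtain ⟨z, hz, h⟩ := ih b a
    exact ⟨z, hz.symm, by rw [altProd, h, altProd, mul_assoc]⟩

theorem altProd_one_one {A : Type*} [Monoid A] (n : ℕ) : altProd (1 : A) 1 n = 1 := by
  induction n with
  | zero => rfl
  | succ n ih => rw [altProd, ih, one_mul]

namespace CoxeterMatrix

variable {S : Type*} (M : CoxeterMatrix S)

/-- The word length on the Artin–Tits monoid. -/
def artinLength : M.ArtinMonoid →* Multiplicative ℕ :=
  PresentedMonoid.lift (fun _ => Multiplicative.ofAdd 1) (by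
    rintro _ _ ⟨s, t⟩
    simp [map_altProd])

open Classical in
/-- The homomorphism to `{0, 1}` whose value at `p` is `1` if and only if all letters of `p`
belong to `J`. -/
noncomputable def parabolicIndicator (J : Set S) : M.ArtinMonoid →* ℕ :=
  PresentedMonoid.lift (fun r => if r ∈ J then 1 else 0) (by
    rintro _ _ ⟨s, t⟩
    rw [map_altProd, map_altProd, FreeMonoid.lift_eval_of, FreeMonoid.lift_eval_of]
    rcases h : M s t with _ | _ | m
    · rfl
    · have : s = t := by
        by_contra hne
        exact M.off_diagonal s t hne (by simpa using h)
      rw [this]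
    · rw [altProd_of_idempotent, altProd_of_idempotent, mul_comm] <;> split_ifs <;> rfl)

variable {M}

theorem parabolicIndicator_of {J : Set S} {r : S} :
    M.parabolicIndicator J (PresentedMonoid.of _ r) = 1 ↔ r ∈ J := by
  simp [parabolicIndicator]

/-- The element `(s, t)_{m_{st}}` of the Artin–Tits monoid. -/
def pairDelta (M : CoxeterMatrix S) (s t : S) : M.ArtinMonoid :=
  altProd (PresentedMonoid.of _ s) (PresentedMonoid.of _ t) (M s t)

theorem pairDelta_comm (s t : S) : M.pairDelta s t = M.pairDelta t s := by
  have h := PresentedMonoid.mk_eq_mk_of_rel (ArtinRel.braid (M := M) s t)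
  rw [map_altProd, map_altProd] at h
  rw [pairDelta, pairDelta, M.symmetric t s]
  exact h

theorem of_dvd_pairDelta {s t : S} (h : M s t ≠ 0) :
    (PresentedMonoid.of _ s : M.ArtinMonoid) ∣ M.pairDelta s t := by
  obtain ⟨n, hn⟩ := Nat.exists_eq_succ_of_ne_zero h
  rw [pairDelta, hn]
  exact ⟨_, rfl⟩

/-- Prepending `s` to `(t,s)_m` gives `(s,t)_{m+1}`, which is `(s,t)_m` followed by its last letter
`z`. -/
theorem exists_of_mul_pairDelta (s t : S) :
    ∃ z, (z = s ∨ z = t) ∧ (PresentedMonoid.of _ s : M.ArtinMonoid) * M.pairDelta s t =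
      M.pairDelta s t * PresentedMonoid.of _ z := by
  obtain ⟨z, hz, h⟩ := exists_altProd_succ_eq_mul (PresentedMonoid.of M.ArtinRel s)
    (PresentedMonoid.of M.ArtinRel t) (M s t)
  have h' : (PresentedMonoid.of _ s : M.ArtinMonoid) * M.pairDelta s t =
      M.pairDelta s t * z := by
    have e : (PresentedMonoid.of _ s : M.ArtinMonoid) * M.pairDelta t s =
        M.pairDelta s t * z := by
      rw [pairDelta, pairDelta, M.symmetric t s]
      exact h
    rwa [pairDelta_comm t s] at e
  rcases hz with rfl | rfl
  · exact ⟨s, .inl rfl, h'⟩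
  · exact ⟨t, .inr rfl, h'⟩

theorem exists_of_mul_pairDelta_pow {s t r : S} (hr : r = s ∨ r = t) (n : ℕ) :
    ∃ z, (z = s ∨ z = t) ∧ (PresentedMonoid.of _ r : M.ArtinMonoid) * M.pairDelta s t ^ n =
      M.pairDelta s t ^ n * PresentedMonoid.of _ z := by
  induction n generalizing r with
  | zero => exact ⟨r, hr, by simp⟩
  | succ n ih =>
    have step : ∃ z, (z = s ∨ z = t) ∧
        (PresentedMonoid.of _ r : M.ArtinMonoid) * M.pairDelta s t =
          M.pairDelta s t * PresentedMonoid.of _ z := by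
      rcases hr with rfl | rfl
      · exact exists_of_mul_pairDelta _ t
      · obtain ⟨z, hz, h⟩ := exists_of_mul_pairDelta (M := M) r s
        exact ⟨z, hz.symm, by rwa [pairDelta_comm s r]⟩
    obtain ⟨z, hz, h⟩ := step
    obtain ⟨y, hy, h'⟩ := ih hz
    exact ⟨y, hy, by rw [pow_succ', ← mul_assoc, h, mul_assoc, h', mul_assoc]⟩

/-- If `w` divides `Δ ^ n`, then `r w` divides `r Δ ^ n = Δ ^ n z`, and `z` divides `Δ`. This makes
`pairPoint` directed. -/
theorem exists_dvd_pairDelta_pow {s t : S} (h : M s t ≠ 0) (p : M.ArtinMonoid)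
    (hp : M.parabolicIndicator {s, t} p = 1) : ∃ n, p ∣ M.pairDelta s t ^ n := by
  obtain ⟨w, rfl⟩ := PresentedMonoid.surjective_mk p
  induction w using FreeMonoid.inductionOn' with
  | one => exact ⟨0, by simp⟩
  | of_mul r w ih =>
    rw [map_mul, map_mul] at hp
    have hr : r ∈ ({s, t} : Set S) := parabolicIndicator_of.1 (Nat.eq_one_of_mul_eq_one_right hp)
    obtain ⟨n, hn⟩ := ih (Nat.eq_one_of_mul_eq_one_left hp)
    obtain ⟨z, hz, e⟩ := exists_of_mul_pairDelta_pow (M := M) hr n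
    have hzd : (PresentedMonoid.of _ z : M.ArtinMonoid) ∣ M.pairDelta s t := by
      rcases hz with rfl | rfl
      · exact of_dvd_pairDelta h
      · rw [pairDelta_comm]
        exact of_dvd_pairDelta (by rwa [M.symmetric])
    refine ⟨n + 1, ?_⟩
    rw [map_mul, pow_succ]
    exact (mul_dvd_mul_left _ hn).trans (e ▸ mul_dvd_mul_left _ hzd)

theorem parabolicIndicator_pairDelta_pow (s t : S) (n : ℕ) :
    M.parabolicIndicator {s, t} (M.pairDelta s t ^ n) = 1 := by
  rw [map_pow, pairDelta, map_altProd, parabolicIndicator_of.2 (by simp),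
    parabolicIndicator_of.2 (by simp), altProd_one_one, one_pow]

/-- The point of the spectrum given by the submonoid generated by `s` and `t`. -/
noncomputable def pairPoint (M : CoxeterMatrix S) {s t : S} (h : M s t ≠ 0) :
    MonoidSpectrum M.ArtinMonoid where
  carrier := {p | M.parabolicIndicator {s, t} p = 1}
  nonempty := ⟨1, map_one _⟩
  hereditary := by
    rintro _ hg k ⟨c, rfl⟩
    rw [Set.mem_ofPred_eq, map_mul] at hg
    exact Nat.eq_one_of_mul_eq_one_right hg
  directed := by
    intro g hg k hk
    obtain ⟨m, hm⟩ := exists_dvd_pairDelta_pow h g hg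
    obtain ⟨n, hn⟩ := exists_dvd_pairDelta_pow h k hk
    exact ⟨_, parabolicIndicator_pairDelta_pow s t (m + n),
      hm.trans (pow_dvd_pow _ (Nat.le_add_right m n)),
      hn.trans (pow_dvd_pow _ (Nat.le_add_left n m))⟩

theorem mem_pairPoint {s t : S} (h : M s t ≠ 0) (p : M.ArtinMonoid) :
    p ∈ (M.pairPoint h).carrier ↔ M.parabolicIndicator {s, t} p = 1 := Iff.rfl

theorem pairPoint_mem_tildeInfty [Finite S] {s t : S} (h : M s t ≠ 0) (hS : 3 ≤ Nat.card S) :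
    M.pairPoint h ∈ MonoidSpectrum.tildeInfty M.ArtinMonoid := by
  constructor
  · intro p hp
    have mem : p ∈ (M.pairPoint h).carrier := by rw [hp]; exact dvd_refl p
    have mem' : p * PresentedMonoid.of _ s ∈ (M.pairPoint h).carrier := by
      rw [mem_pairPoint, map_mul, (mem_pairPoint h p).1 mem, parabolicIndicator_of.2 (by simp)]
    rw [hp] at mem'
    obtain ⟨c, hc⟩ := mem'
    have e := congrArg (fun q => Multiplicative.toAdd (M.artinLength q)) hc
    simp [artinLength] at e
    omega
  · intro huniv
    have hcard : ∃ r : S, r ∉ ({s, t} : Set S) := by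
      by_contra! hall
      have : ({s, t} : Set S) = Set.univ := Set.eq_univ_of_forall hall
      have h2 := Set.ncard_insert_le s {t}
      rw [this, Set.ncard_univ, Set.ncard_singleton] at h2
      omega
    obtain ⟨r, hr⟩ := hcard
    refine hr (parabolicIndicator_of.1 ((mem_pairPoint h (PresentedMonoid.of _ r)).1 ?_))
    rw [huniv]
    trivial

theorem actsTo_pairPoint {s t r : S} (h : M s t ≠ 0) (hr : r = s ∨ r = t) (k : ℕ) :
    MonoidSpectrum.ActsTo M.artinMonoidToGroup (PresentedGroup.of r ^ k)
      (M.pairPoint h) (M.pairPoint h) := by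
  have hp : M.parabolicIndicator {s, t} (PresentedMonoid.of _ r ^ k) = 1 := by
    rw [map_pow, parabolicIndicator_of.2 (show r ∈ ({s, t} : Set S) from hr), one_pow]
  refine ⟨PresentedMonoid.of _ r ^ k, 1, ?_, (M.pairPoint h).one_mem, hp, fun q => ?_⟩
  · simp [artinMonoidToGroup]
  · rw [mem_pairPoint, mem_pairPoint, map_mul, hp, one_mul, one_mul]

end CoxeterMatrix

end Parabolic

/-! ### Ping-pong in the isotropy group -/

theorem mainTheorem6 {S : Type*} [Finite S] (M : CoxeterMatrix S) (hM : M.IsFiniteType)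
    (hS : 3 ≤ Nat.card S) (hst : ∃ s t : S, 2 < M s t) :
    ¬ IsAmenableGroupoid
        (TransformationGroupoid M.artinMonoidToGroup
          (MonoidSpectrum.tildeInfty M.ArtinMonoid)) := by
  obtain ⟨s, t, hst⟩ := hst
  have hts : 2 < M t s := by rwa [M.symmetric]
  have h0 : M s t ≠ 0 := by omega
  have := Fintype.ofFinite S
  let x : TransformationGroupoid M.artinMonoidToGroup
      (MonoidSpectrum.tildeInfty M.ArtinMonoid) :=
    ⟨M.pairPoint h0, M.pairPoint_mem_tildeInfty h0 hS⟩
  have pow_mul (r : S) (g : M.ArtinGroup) :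
      PresentedGroup.of r ^ 3 * PresentedGroup.of r ^ 3 * g = PresentedGroup.of r ^ 6 * g := by
    rw [← pow_add]
  -- Composing an arrow with an isotropy element multiplies its group label on the left, as in the
  -- row estimates.
  refine not_isAmenableGroupoid_of_isotropy (u := x)
    ⟨PresentedGroup.of s ^ 3, M.actsTo_pairPoint h0 (.inl rfl) 3⟩
    ⟨PresentedGroup.of t ^ 3, M.actsTo_pairPoint h0 (.inr rfl) 3⟩
    {β | ‖M.artinRow t β.2.1‖ ≤ ‖M.artinRow s β.2.1‖}
    {β | ‖M.artinRow s β.2.1‖ ≤ ‖M.artinRow t β.2.1‖}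
    ?_ ?_ ?_ ?_ fun β => le_total ‖M.artinRow t β.2.1‖ ‖M.artinRow s β.2.1‖
  · exact fun β hβ hβ' => (M.norm_artinRow_lt hst hβ le_rfl).not_ge hβ'
  · intro β hβ hβ'
    have := M.norm_artinRow_lt hst hβ (k := 6) (by norm_num)
    rw [← pow_mul] at this
    exact this.not_ge hβ'
  · exact fun β hβ hβ' => (M.norm_artinRow_lt hts hβ le_rfl).not_ge hβ'
  · intro β hβ hβ'
    have := M.norm_artinRow_lt hts hβ (k := 6) (by norm_num)
    rw [← pow_mul] at this
    exact this.not_ge hβ'
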